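/- Let $R$ be a real closed field, ordered by its unique ordering. A cut of a linearly ordered set $A$ is a pair $(L,U)$ of (possibly empty) subsets with $L\cup U=A$ and $l<u$ for all $l\in L$, $u\in U$. For an ordered field $F$, the natural valuation $v$ is the valuation whose valuation ring is the convex hull of $\mathbb Q$ in $F$; its value group is denoted $vF$ and written additively, with $v(0)=\infty$. For a cut $(S,T)$ of $vR$ and $a\in R$, the set $B=\{b\in R : v(b-a)\in T\cup\{\infty\}\}$ is called an ultrametric ball in $R$; it determines the two cuts $$B^-=\bigl(\{c\in R: c<b\ \text{for all } b\in B\},\ \{c\in R: c\ge b\ \text{for some } b\in B\}\bigr),$$ $$B^+=\bigl(\{c\in R: c\le b\ \text{for some } b\in B\},\ \{c\in R: c>b\ \text{for all } b\in B\}\bigr)$$ of $R$, and the cuts of this form are called ball cuts. Proposition. Let $C=(L,U)$ be a cut of $R$. Then there is exactly one ordering $P$ of the rational function field $R(x)$ that corresponds to $C$, i.e. such that $L=\{a\in R: a<_P x\}$ and $U=\{b\in R: x<_P b\}$. Let $v_P$ be the natural valuation of $R(x)$ with respect to $P$, with value group $v_PR(x)$. Then $$C\text{ is a ball cut}\iff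 [\,v_PR(x):2\,v_PR(x)\,]=2 .$$ -/

import Mathlib

/-- A cut of a linearly ordered set: a pair `(L, U)` of subsets that together exhaust the set,
with every element of `L` strictly below every element of `U`. Either set may be empty. -/
@[ext]
structure OrderCut (A : Type*) [LinearOrder A] where
  lower : Set A
  upper : Set A
  union_eq : lower ∪ upper = Set.univ
  lt_of_mem : ∀ l ∈ lower, ∀ u ∈ upper, l < u

namespace OrderCut

/-- The cut `S⁻ = ({a | a < S}, {a | ∃ s ∈ S, s ≤ a})` at the lower edge of a subset `S`. -/
def lowerEdge {A : Type*} [LinearOrder A] (S : Set A) : OrderCut A where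
  lower := {a | ∀ s ∈ S, a < s}
  upper := {a | ∃ s ∈ S, s ≤ a}
  union_eq := by
    ext a
    simp only [Set.mem_union, Set.mem_ofPred_eq, Set.mem_univ, iff_true]
    by_contra! h
    obtain ⟨⟨s, hs, hsa⟩, h2⟩ := h
    exact absurd (h2 s hs) (not_lt.mpr hsa)
  lt_of_mem := by
    rintro l hl u ⟨s, hs, hsu⟩
    exact (hl s hs).trans_le hsu

/-- The cut `S⁺ = ({a | ∃ s ∈ S, a ≤ s}, {a | a > S})` at the upper edge of a subset `S`. -/
def upperEdge {A : Type*} [LinearOrder A] (S : Set A) : OrderCut A where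
  lower := {a | ∃ s ∈ S, a ≤ s}
  upper := {a | ∀ s ∈ S, s < a}
  union_eq := by
    ext a
    simp only [Set.mem_union, Set.mem_ofPred_eq, Set.mem_univ, iff_true]
    by_contra! h
    obtain ⟨h1, ⟨s, hs, hsa⟩⟩ := h
    exact absurd (h1 s hs) (not_lt.mpr hsa)
  lt_of_mem := by
    rintro l ⟨s, hs, hls⟩ u hu
    exact hls.trans_lt (hu s hs)

end OrderCut

section NaturalValuation

variable (F : Type*) [Field F] [LinearOrder F] [IsStrictOrderedRing F]

/-- The natural valuation of an ordered field `F`, written additively, with values in the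
value group together with `⊤ = ∞`: it sends an element to its archimedean class. -/
noncomputable def naturalValuation : AddValuation F (ArchimedeanClass F) :=
  ArchimedeanClass.addValuation F

/-- The valuation ring of the natural valuation is the convex hull of the rationals. -/
theorem naturalValuation_nonneg_iff (f : F) :
    0 ≤ naturalValuation F f ↔ ∃ p q : ℚ, (p : F) ≤ f ∧ f ≤ (q : F) := by
  change 0 ≤ ArchimedeanClass.mk f ↔ _
  constructor
  · intro h
    obtain ⟨m, hm⟩ := ArchimedeanClass.exists_int_le_of_mk_nonneg h
    obtain ⟨n, hn⟩ := ArchimedeanClass.exists_int_ge_of_mk_nonneg h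
    exact ⟨m, n, by simpa using hm, by simpa using hn⟩
  · rintro ⟨p, q, hp, hq⟩
    exact (le_min (ArchimedeanClass.mk_ratCast_nonneg p)
      (ArchimedeanClass.mk_ratCast_nonneg q)).trans
      (ArchimedeanClass.min_le_mk_of_le_of_le hp hq)

/-- The value group `vF`: the finite (that is, additively invertible) values of the natural
valuation. It is a linearly ordered additive abelian group. -/
abbrev NaturalValueGroup : Type _ := AddUnits (ArchimedeanClass F)

/-- The index `[vF : 2vF]` (equal to `0` by convention if it is infinite). -/
noncomputable def naturalValueIndexTwo : ℕ :=
  (nsmulAddMonoidHom (α := NaturalValueGroup F) 2).range.index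

end NaturalValuation

section Balls

variable {R : Type*} [Field R] [LinearOrder R] [IsStrictOrderedRing R]

/-- For a cut `S` of the value group, with upper cut set `U`, the ultrametric ball
`{b | v (b - a) ∈ U ∪ {∞}}` with center `a` and radius `U`. -/
def ultrametricBall (S : OrderCut (NaturalValueGroup R)) (a : R) : Set R :=
  {b | naturalValuation R (b - a) = ⊤ ∨
    ∃ u ∈ S.upper, naturalValuation R (b - a) = (u : ArchimedeanClass R)}

/-- A ball cut is a cut at the lower or at the upper edge of an ultrametric ball. -/
def OrderCut.IsBallCut (C : OrderCut R) : Prop :=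
  ∃ (S : OrderCut (NaturalValueGroup R)) (a : R),
    C = OrderCut.lowerEdge (ultrametricBall S a) ∨ C = OrderCut.upperEdge (ultrametricBall S a)

end Balls

/-- An ordering of a field: a linear order compatible with the field operations. -/
structure FieldOrdering (F : Type*) [Field F] where
  order : LinearOrder F
  isStrictOrderedRing : IsStrictOrderedRing F

namespace FieldOrdering

/-- The index `[vF : 2vF]` for the natural valuation `v` of the ordering `P` of `F`. -/
noncomputable def valueIndexTwo {F : Type*} [Field F] (P : FieldOrdering F) : ℕ :=
  letI := P.order
  haveI := P.isStrictOrderedRing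
  naturalValueIndexTwo F

/-- The ordering `P` of `R(x)` corresponds to the cut
`({a | a < x with respect to P}, {b | x < b with respect to P})` of `R`. -/
def CorrespondsTo {R : Type*} [Field R] [LinearOrder R]
    (P : FieldOrdering (RatFunc R)) (C : OrderCut R) : Prop :=
  C.lower = {a | P.order.lt (RatFunc.C a) RatFunc.X} ∧
    C.upper = {b | P.order.lt RatFunc.X (RatFunc.C b)}

end FieldOrdering

/-! Both sides of the equivalence say that some `x - a` has a value outside `vR`. Over a real closed
field every irreducible polynomial is, up to a unit, `X - a` or `(X - a)² + b²` with `b ≠ 0`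
(`IsRealClosed.associated_of_irreducible`), and the latter is positive in every ordering. So the
signs of the `x - a` determine the ordering, which gives uniqueness; existence comes from filling
the cut in an ultrapower of `R`. A sum of two squares has the value of one of them, so the values of
the `x - a` and of the constants generate `v_P R(x)`. The group `vR` is divisible by two. If it
contains all `v(x - a)`, then `v_P R(x)` is 2-divisible. If `v(x - a₀)` lies outside, it generates
`v_P R(x)` together with `vR`; odd roots in `R` show that its odd multiples stay out of `2 v_P
R(x)`, so the index is two (`naturalValueIndexTwo_eq_two_iff`). If `v(x - a)` is not in `vR`, it
cuts `vR`, and `x` sits at an edge of the resulting ball around `a`. Conversely, if `x` sits at an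
edge of a ball around `a` and `v(x - a)` were in `vR`, then `|x - a|` would lie between two elements
of `R` of equal value, which the ball cannot separate. -/

open Polynomial

/-! ### Galois theory over fields in which every element is a square -/

section QuadraticExtension

/-- Over a field of characteristic different from two in which every element is a square, no
extension has degree two. -/
theorem finrank_ne_two_of_forall_isSquare {K M : Type*} [Field K] [Field M] [Algebra K M]
    [NeZero (2 : K)] (hK : ∀ z : K, IsSquare z) : Module.finrank K M ≠ 2 := by
  intro h2
  have : FiniteDimensional K M := Module.finite_of_finrank_pos (by omega)
  have hne : ∃ θ : M, θ ∉ (algebraMap K M).range := by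
    by_contra! hall
    have hbot : (⊥ : Subalgebra K M) = ⊤ := by
      rw [eq_top_iff]
      intro θ _
      exact Algebra.mem_bot.mpr (hall θ)
    have := Subalgebra.bot_eq_top_iff_finrank_eq_one.mp hbot
    omega
  obtain ⟨θ, hθ⟩ := hne
  have h_integral : IsIntegral K θ := Algebra.IsIntegral.isIntegral θ
  have hirr := minpoly.irreducible h_integral
  have hdeg : (minpoly K θ).natDegree ≤ 2 := h2 ▸ minpoly.natDegree_le θ
  have hne1 : (minpoly K θ).natDegree ≠ 1 := fun h => hθ (minpoly.natDegree_eq_one_iff.mp h)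
  have hpos := minpoly.natDegree_pos h_integral
  have hdeg2 : (minpoly K θ).natDegree = 2 := by omega
  have hlead : (minpoly K θ).coeff 2 = 1 := by
    have := (minpoly.monic h_integral).coeff_natDegree
    rwa [hdeg2] at this
  obtain ⟨s, hs⟩ := hK (discrim 1 ((minpoly K θ).coeff 1) ((minpoly K θ).coeff 0))
  obtain ⟨r, hr⟩ := exists_quadratic_eq_zero one_ne_zero ⟨s, hs⟩
  have hroot : (minpoly K θ).IsRoot r := by
    rw [IsRoot.def, eval_eq_sum_range, hdeg2]
    simp only [Finset.sum_range_succ, Finset.sum_range_zero, hlead]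
    linear_combination hr
  exact hne1 (natDegree_eq_of_degree_eq_some (degree_eq_one_of_irreducible_of_root hirr hroot))

/-- A Galois extension of degree a power of two of a field in which every element is a square is
trivial. -/
theorem finrank_eq_one_of_forall_isSquare {K L : Type*} [Field K] [Field L] [Algebra K L]
    [NeZero (2 : K)] [FiniteDimensional K L] [IsGalois K L] (hK : ∀ z : K, IsSquare z)
    {n : ℕ} (hn : Module.finrank K L = 2 ^ n) : Module.finrank K L = 1 := by
  rcases n with _ | n
  · simpa using hn
  exfalso
  -- `H` has index two, so its fixed field would be a quadratic extension of `K`.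
  obtain ⟨H, hH⟩ := Sylow.exists_subgroup_card_pow_prime (G := Gal(L/K)) 2 (n := n)
    (by rw [IsGalois.card_aut_eq_finrank, hn]; exact pow_dvd_pow 2 n.le_succ)
  have h1 := IntermediateField.finrank_fixedField_eq_card H
  have h2 := Module.finrank_mul_finrank K (IntermediateField.fixedField H) L
  rw [h1, hH, hn, pow_succ'] at h2
  exact finrank_ne_two_of_forall_isSquare (M := IntermediateField.fixedField H) hK
    (Nat.eq_of_mul_eq_mul_right (by positivity) h2)

/-- The elements of `R(i)` have the form `a + b i`. -/
theorem IntermediateField.exists_eq_add_mul_of_mem_adjoin {R L : Type*} [Field R] [Field L] [Algebra R L] {i : L}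
    (hi : i ^ 2 = -1) (z : IntermediateField.adjoin R {i}) :
    ∃ a b : R, (z : L) = algebraMap R L a + algebraMap R L b * i := by
  have hmonic : (X ^ 2 + 1 : R[X]).Monic := by monicity!
  have h_integral : IsIntegral R i := ⟨X ^ 2 + 1, hmonic, by simp [hi]⟩
  obtain ⟨f, hf⟩ := (IntermediateField.adjoin.powerBasis h_integral).exists_eq_aeval' z
  have hz : (z : L) = aeval i f := by
    rw [hf]
    change (IntermediateField.adjoin R {i}).val _ = _
    rw [← aeval_algHom_apply]
    simp
  have hdeg : (f %ₘ (X ^ 2 + 1)).natDegree < 2 := by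
    have := natDegree_modByMonic_lt f hmonic (by
      intro h
      have := congrArg natDegree h
      rw [show (X ^ 2 + 1 : R[X]).natDegree = 2 by compute_degree!, natDegree_one] at this
      omega)
    rwa [show (X ^ 2 + 1 : R[X]).natDegree = 2 by compute_degree!] at this
  refine ⟨(f %ₘ (X ^ 2 + 1)).coeff 0, (f %ₘ (X ^ 2 + 1)).coeff 1, ?_⟩
  rw [hz, ← aeval_modByMonic_eq_self_of_root (p := f) (q := X ^ 2 + 1) (x := i) (by simp [hi]),
    aeval_eq_sum_range' hdeg]
  simp [Finset.sum_range_succ, Algebra.smul_def]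

end QuadraticExtension

/-! ### Irreducible polynomials over a real closed field -/

namespace IsRealClosed

variable {R : Type*} [Field R] [IsRealClosed R]

/-- A real closed field has no nontrivial separable extension of odd degree. -/
theorem finrank_eq_one_of_odd {M : Type*} [Field M] [Algebra R M] [FiniteDimensional R M]
    [Algebra.IsSeparable R M] (hodd : Odd (Module.finrank R M)) : Module.finrank R M = 1 := by
  obtain ⟨α, hα⟩ := Field.exists_primitive_element R M
  rw [Field.primitive_element_iff_minpoly_natDegree_eq] at hα
  obtain ⟨r, hr⟩ := exists_isRoot_of_odd_natDegree (R := R) (f := minpoly R α) (hα ▸ hodd)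
  rw [← hα]
  exact natDegree_eq_of_degree_eq_some (degree_eq_one_of_irreducible_of_root
    (minpoly.irreducible (Algebra.IsIntegral.isIntegral α)) hr)

/-- A finite Galois extension of a real closed field has degree a power of two. -/
theorem exists_finrank_eq_two_pow (L : Type*) [Field L] [Algebra R L] [FiniteDimensional R L]
    [IsGalois R L] : ∃ n, Module.finrank R L = 2 ^ n := by
  -- The fixed field of a Sylow 2-subgroup has odd degree, hence is `R`, so the Galois group is a
  -- 2-group.
  obtain ⟨H⟩ : Nonempty (Sylow 2 Gal(L/R)) := inferInstance
  have hidx : Odd (Module.finrank R (IntermediateField.fixedField (H : Subgroup Gal(L/R)))) := by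
    rw [IntermediateField.finrank_eq_fixingSubgroup_index,
      IntermediateField.fixingSubgroup_fixedField, ← Nat.not_even_iff_odd, even_iff_two_dvd]
    exact H.not_dvd_index
  have h1 := finrank_eq_one_of_odd hidx
  have h2 := Module.finrank_mul_finrank R
    (IntermediateField.fixedField (H : Subgroup Gal(L/R))) L
  rw [h1, one_mul, IntermediateField.finrank_fixedField_eq_card] at h2
  exact ⟨_, by rw [← h2, H.card_eq_multiplicity]⟩

variable [LinearOrder R] [IsStrictOrderedRing R]

/-- Every element of `R(i)` is a square. -/
theorem exists_sq_eq_add_mul {L : Type*} [CommRing L] [Algebra R L] {i : L} (hi : i ^ 2 = -1)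
    (a b : R) : ∃ c d : R, (algebraMap R L c + algebraMap R L d * i) ^ 2 =
      algebraMap R L a + algebraMap R L b * i := by
  obtain ⟨r, hr⟩ := exists_eq_pow_of_nonneg (add_nonneg (sq_nonneg a) (sq_nonneg b)) two_ne_zero
  have hrn : ∃ r : R, 0 ≤ r ∧ r ^ 2 = a ^ 2 + b ^ 2 := ⟨|r|, abs_nonneg r, by rw [sq_abs, hr]⟩
  obtain ⟨r, hr0, hr⟩ := hrn
  have hle := abs_le.mp (abs_le_of_sq_le_sq (a := a) (b := r) (by nlinarith [sq_nonneg b]) hr0)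
  -- The usual complex square root, with `r = |a + b i|`. The product `2cd` is only known up to
  -- sign, so `d` may have to be negated.
  obtain ⟨c, hc⟩ := exists_eq_pow_of_nonneg (x := (r + a) / 2)
    (by linarith [hle.1]) two_ne_zero
  obtain ⟨d, hd⟩ := exists_eq_pow_of_nonneg (x := (r - a) / 2)
    (by linarith [hle.2]) two_ne_zero
  have hcd : (2 * c * d) ^ 2 = b ^ 2 := by
    have : (2 * c * d) ^ 2 = 4 * (c ^ 2 * d ^ 2) := by ring
    rw [this, ← hc, ← hd]; linear_combination hr
  have key : ∀ c d : R, c ^ 2 - d ^ 2 = a → 2 * c * d = b →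
      (algebraMap R L c + algebraMap R L d * i) ^ 2 = algebraMap R L a + algebraMap R L b * i := by
    intro c d h1 h2
    rw [← h1, ← h2]
    simp only [map_sub, map_mul, map_pow, map_ofNat]
    linear_combination (algebraMap R L d) ^ 2 * hi
  rcases sq_eq_sq_iff_eq_or_eq_neg.mp hcd with h | h
  · exact ⟨c, d, key c d (by rw [← hc, ← hd]; ring) h⟩
  · exact ⟨c, -d, key c (-d) (by rw [neg_sq, ← hc, ← hd]; ring) (by linear_combination -h)⟩

/-- Every irreducible polynomial over a real closed field divides a polynomial of the form
`(X - a) ^ 2 + b ^ 2`. -/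
theorem exists_dvd_of_irreducible {p : R[X]} (hp : Irreducible p) :
    ∃ a b : R, p ∣ (X - C a) ^ 2 + C b ^ 2 := by
  -- The extra factor puts `i` into the splitting field, which then turns out to be `R(i)`.
  let q : R[X] := p * (X ^ 2 + 1)
  have hX : (X ^ 2 + 1 : R[X]) ≠ 0 := by
    have : (X ^ 2 + 1 : R[X]).Monic := by monicity!
    exact this.ne_zero
  have hq : q ≠ 0 := mul_ne_zero hp.ne_zero hX
  let L := q.SplittingField
  have : CharZero R := inferInstance
  have : IsGalois R L := ⟨⟩
  have hsplit : (q.map (algebraMap R L)).Splits := SplittingField.splits q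
  have hroot : ∀ f : R[X], f ∣ q → f.natDegree ≠ 0 → ∃ z : L, aeval z f = 0 := by
    intro f hf hdeg
    have hs : (f.map (algebraMap R L)).Splits :=
      hsplit.of_dvd (by simpa [Polynomial.map_eq_zero] using hq) (Polynomial.map_dvd _ hf)
    obtain ⟨z, hz⟩ := hs.exists_eval_eq_zero (by
      rw [degree_map]
      exact fun h => hdeg (natDegree_eq_of_degree_eq_some h))
    exact ⟨z, by rwa [aeval_def, ← eval_map]⟩
  obtain ⟨i, hi⟩ := hroot (X ^ 2 + 1) (dvd_mul_left _ _)
    (by rw [show (X ^ 2 + 1 : R[X]).natDegree = 2 by compute_degree!]; norm_num)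
  obtain ⟨θ, hθ⟩ := hroot p (dvd_mul_right _ _) hp.natDegree_pos.ne'
  replace hi : i ^ 2 = -1 := by
    simp only [map_add, map_pow, aeval_X, map_one] at hi
    linear_combination hi
  let K := IntermediateField.adjoin R {i}
  have hsq : ∀ z : K, IsSquare z := by
    intro z
    obtain ⟨a, b, hz⟩ := IntermediateField.exists_eq_add_mul_of_mem_adjoin hi z
    obtain ⟨c, d, hcd⟩ := exists_sq_eq_add_mul hi a b
    refine ⟨algebraMap R K c + algebraMap R K d *
      ⟨i, IntermediateField.mem_adjoin_simple_self R i⟩, Subtype.ext ?_⟩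
    rw [hz, ← hcd, sq]
    rfl
  obtain ⟨n, hn⟩ := exists_finrank_eq_two_pow (R := R) L
  have htower := Module.finrank_mul_finrank R K L
  obtain ⟨m, -, hm⟩ := (Nat.dvd_prime_pow Nat.prime_two).mp
    (hn ▸ Dvd.intro_left _ htower : Module.finrank K L ∣ 2 ^ n)
  have h1 := finrank_eq_one_of_forall_isSquare (K := K) (L := L) hsq hm
  have hK : K = ⊤ := IntermediateField.finrank_eq_one_iff_eq_top.mp h1
  obtain ⟨a, b, hab⟩ := IntermediateField.exists_eq_add_mul_of_mem_adjoin hi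
    (⟨θ, by change θ ∈ K; rw [hK]; trivial⟩ : IntermediateField.adjoin R {i})
  refine ⟨a, b, ?_⟩
  have hassoc := minpoly.dvd R θ (p := (X - C a) ^ 2 + C b ^ 2) (by
    simp only [map_add, map_pow, map_sub, aeval_X, aeval_C]
    change θ = _ at hab
    rw [hab]
    linear_combination (algebraMap R L b) ^ 2 * hi)
  refine dvd_trans ?_ hassoc
  exact ((minpoly.irreducible (Algebra.IsIntegral.isIntegral θ)).associated_of_dvd hp
    (minpoly.dvd R θ hθ)).symm.dvd

/-- An irreducible polynomial over a real closed field is, up to a constant factor, either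
`X - a` or `(X - a) ^ 2 + b ^ 2` with `b ≠ 0`. -/
theorem associated_of_irreducible {p : R[X]} (hp : Irreducible p) :
    (∃ a : R, Associated p (X - C a)) ∨
      ∃ a b : R, b ≠ 0 ∧ Associated p ((X - C a) ^ 2 + C b ^ 2) := by
  obtain ⟨a, b, hab⟩ := exists_dvd_of_irreducible hp
  rcases eq_or_ne b 0 with rfl | hb
  · left
    refine ⟨a, hp.associated_of_dvd (irreducible_X_sub_C a) ?_⟩
    exact hp.prime.dvd_of_dvd_pow (n := 2) (by simpa using hab)
  · right
    refine ⟨a, b, hb, hp.associated_of_dvd ?_ hab⟩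
    refine irreducible_of_degree_le_three_of_not_isRoot ?_ ?_
    · rw [show ((X - C a) ^ 2 + C b ^ 2 : R[X]).natDegree = 2 by compute_degree!]
      simp
    · intro x hx
      have : (x - a) ^ 2 + b ^ 2 = 0 := by simpa using hx
      have := sq_nonneg (x - a)
      have := pow_pos (abs_pos.mpr hb) 2
      rw [sq_abs] at this
      linarith

/-- Induction principle for nonzero polynomials over a real closed field. -/
theorem polynomial_induction {motive : R[X] → Prop} (const : ∀ a : R, a ≠ 0 → motive (C a))
    (linear : ∀ a : R, motive (X - C a))
    (quadratic : ∀ a b : R, b ≠ 0 → motive ((X - C a) ^ 2 + C b ^ 2))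
    (mul : ∀ f g : R[X], f ≠ 0 → g ≠ 0 → motive f → motive g → motive (f * g))
    {f : R[X]} (hf : f ≠ 0) : motive f := by
  have unit : ∀ u : R[X], IsUnit u → motive u := by
    intro u hu
    obtain ⟨r, hr, rfl⟩ := Polynomial.isUnit_iff.mp hu
    exact const r hr.ne_zero
  have irred : ∀ p : R[X], Irreducible p → motive p := by
    intro p hp
    have assoc : ∀ q : R[X], motive q → Associated p q → motive p := by
      rintro q hq hpq
      obtain ⟨u, rfl⟩ := hpq.symm
      have hne := hp.ne_zero
      exact mul _ _ (left_ne_zero_of_mul hne) u.ne_zero hq (unit _ u.isUnit)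
    rcases associated_of_irreducible hp with ⟨a, h⟩ | ⟨a, b, hb, h⟩
    · exact assoc _ (linear a) h
    · exact assoc _ (quadratic a b hb) h
  refine WfDvdMonoid.induction_on_irreducible (motive := fun f => f ≠ 0 → motive f) f
    (fun h => absurd rfl h) (fun u hu _ => unit u hu) (fun a i ha hi ih _ => ?_) hf
  exact mul _ _ hi.ne_zero ha (irred i hi) (ih ha)

end IsRealClosed

/-! ### Cuts of `R` and orderings of `R(x)` -/

section CutOrdering

variable {R : Type*} [Field R] [LinearOrder R]

namespace OrderCut

theorem mem_lower_or_mem_upper {A : Type*} [LinearOrder A] (C : OrderCut A) (a : A) :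
    a ∈ C.lower ∨ a ∈ C.upper := by
  have := Set.mem_univ a
  rwa [← C.union_eq] at this

theorem mem_upper_iff_notMem_lower {A : Type*} [LinearOrder A] (C : OrderCut A) (a : A) :
    a ∈ C.upper ↔ a ∉ C.lower :=
  ⟨fun hu hl => (C.lt_of_mem a hl a hu).false, fun h => (C.mem_lower_or_mem_upper a).resolve_left h⟩

theorem ext_lower {A : Type*} [LinearOrder A] {C D : OrderCut A} (h : C.lower = D.lower) :
    C = D := by
  refine OrderCut.ext h (Set.ext fun a => ?_)
  rw [mem_upper_iff_notMem_lower, mem_upper_iff_notMem_lower, h]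

variable [IsStrictOrderedRing R]

/-- The order of `R` is dense without endpoints, so any finite part of the cut is filled in `R`
itself; the ultrapower then fills all of it. -/
theorem exists_realizes_finset (C : OrderCut R) (s : Finset R) :
    ∃ y : R, ∀ a ∈ s, (a ∈ C.lower → a < y) ∧ (a ∈ C.upper → y < a) := by
  classical
  obtain ⟨m, h1, h2⟩ := Order.exists_between_finsets (s.filter (· ∈ C.lower))
    (s.filter (· ∈ C.upper)) (by
      intro x hx y hy
      exact C.lt_of_mem x (Finset.mem_filter.mp hx).2 y (Finset.mem_filter.mp hy).2)
  exact ⟨m, fun a ha => ⟨fun h => h1 a (Finset.mem_filter.mpr ⟨ha, h⟩),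
    fun h => h2 a (Finset.mem_filter.mpr ⟨ha, h⟩)⟩⟩

/-- Every cut of an ordered field `R` is realized by an ordering of `R(x)`: embed `R(x)` into an
ultrapower of `R` so that `x` is sent to an element filling the cut. -/
theorem exists_correspondsTo (C : OrderCut R) :
    ∃ P : FieldOrdering (RatFunc R), P.CorrespondsTo C := by
  choose y hy using C.exists_realizes_finset
  -- Finite sets containing a given `s` are `U`-large, so the class of `y` satisfies every condition
  -- of the cut.
  let U : Ultrafilter (Finset R) := Ultrafilter.of Filter.atTop
  have hU : ∀ s : Finset R, ∀ᶠ t in (U : Filter (Finset R)), s ≤ t := fun s =>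
    Ultrafilter.of_le _ (Filter.eventually_ge_atTop s)
  let φ : R[X] →+* Filter.Germ (U : Filter (Finset R)) R :=
    (Filter.Germ.coeRingHom (U : Filter (Finset R))).comp
      (RingHom.pi fun s => evalRingHom (y s))
  have hφ_apply : ∀ f : R[X], φ f = ((fun s => f.eval (y s) : Finset R → R) :
      Filter.Germ (U : Filter (Finset R)) R) := fun f => rfl
  have hne : ∀ (s : Finset R), ∀ a ∈ s, y s ≠ a := by
    intro s a ha hya
    rcases C.mem_lower_or_mem_upper a with h | h
    · exact ((hy s a ha).1 h).ne' hya
    · exact ((hy s a ha).2 h).ne hya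
  -- Once `s` contains the roots of `f`, the point `y s` is not a root.
  have hφ0 : ∀ f : R[X], f ≠ 0 → φ f ≠ 0 := by
    intro f hf h0
    rw [hφ_apply, ← Filter.Germ.coe_zero, Filter.Germ.coe_eq] at h0
    obtain ⟨s, hs0, hs⟩ := (h0.and (hU f.roots.toFinset)).exists
    exact hne s (y s) (hs (Multiset.mem_toFinset.mpr ((mem_roots hf).mpr hs0))) rfl
  have hφ : nonZeroDivisors R[X] ≤ Submonoid.comap φ (nonZeroDivisors _) := by
    intro f hf
    exact mem_nonZeroDivisors_of_ne_zero (hφ0 f (nonZeroDivisors.ne_zero hf))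
  let ψ := RatFunc.liftRingHom φ hφ
  let ord : LinearOrder (RatFunc R) := LinearOrder.lift' ψ ψ.injective
  have hψ : ∀ f : R[X], ψ (algebraMap R[X] (RatFunc R) f) = φ f := by
    intro f
    have := RatFunc.liftRingHom_apply_div φ hφ f 1
    rwa [map_one, map_one, div_one, div_one] at this
  have hlt : ∀ f g : RatFunc R, ord.lt f g ↔ ψ f < ψ g := fun f g => Iff.rfl
  refine ⟨⟨ord, Function.Injective.isStrictOrderedRing ψ (map_zero ψ) (map_one ψ) (map_add ψ)
    (map_mul ψ) Iff.rfl Iff.rfl⟩, ?_⟩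
  have hl : ∀ a ∈ C.lower, ord.lt (RatFunc.C a) RatFunc.X := by
    intro a ha
    rw [hlt, ← RatFunc.algebraMap_C, ← RatFunc.algebraMap_X, hψ, hψ, hφ_apply, hφ_apply,
      Filter.Germ.coe_lt]
    filter_upwards [hU {a}] with s hs
    simpa using (hy s a (hs (Finset.mem_singleton_self a))).1 ha
  have hu : ∀ a ∈ C.upper, ord.lt RatFunc.X (RatFunc.C a) := by
    intro a ha
    rw [hlt, ← RatFunc.algebraMap_C, ← RatFunc.algebraMap_X, hψ, hψ, hφ_apply, hφ_apply,
      Filter.Germ.coe_lt]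
    filter_upwards [hU {a}] with s hs
    simpa using (hy s a (hs (Finset.mem_singleton_self a))).2 ha
  constructor
  · ext a
    refine ⟨hl a, fun h => (C.mem_lower_or_mem_upper a).resolve_right fun ha => ?_⟩
    exact absurd (hu a ha) (@lt_asymm _ ord.toPreorder _ _ h)
  · ext a
    refine ⟨hu a, fun h => (C.mem_lower_or_mem_upper a).resolve_left fun ha => ?_⟩
    exact absurd (hl a ha) (@lt_asymm _ ord.toPreorder _ _ h)

end OrderCut

namespace IsRealClosed

variable [IsStrictOrderedRing R] [IsRealClosed R]

/-- A ring homomorphism from a real closed field to an ordered field is strictly monotone. -/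
theorem strictMono_ringHom {F : Type*} [Field F] [LinearOrder F] [IsStrictOrderedRing F]
    (i : R →+* F) : StrictMono i := by
  intro a b hab
  -- Positive elements are nonzero squares, a property every homomorphism of fields preserves.
  obtain ⟨r, hr⟩ := exists_eq_pow_of_nonneg (sub_nonneg.mpr hab.le) two_ne_zero
  have h0 : i r ≠ 0 := by
    intro h
    rw [map_eq_zero] at h
    rw [h] at hr
    simp [sub_eq_zero, hab.ne'] at hr
  have : 0 < i (b - a) := by
    rw [hr, map_pow]
    positivity
  rwa [map_sub, sub_pos] at this

/-- The sign of a polynomial over a real closed field in an ordered field extension is determined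
by the signs of the linear polynomials. -/
theorem polynomial_pos_iff_pos {F G : Type*} [Field F] [LinearOrder F] [IsStrictOrderedRing F]
    [Field G] [LinearOrder G] [IsStrictOrderedRing G] {φ : R[X] →+* F} {ψ : R[X] →+* G}
    (hφ : Function.Injective φ) (hψ : Function.Injective ψ)
    (h : ∀ a, 0 < φ (X - C a) ↔ 0 < ψ (X - C a)) (f : R[X]) : 0 < φ f ↔ 0 < ψ f := by
  rcases eq_or_ne f 0 with rfl | hf
  · simp
  refine polynomial_induction (motive := fun f => 0 < φ f ↔ 0 < ψ f) ?_ h ?_ ?_ hf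
  · intro a _
    have h1 := (strictMono_ringHom (φ.comp C)).lt_iff_lt (a := 0) (b := a)
    have h2 := (strictMono_ringHom (ψ.comp C)).lt_iff_lt (a := 0) (b := a)
    simp only [RingHom.comp_apply, map_zero] at h1 h2
    rw [h1, h2]
  · intro a b hb
    have hCb : C b ≠ 0 := C_ne_zero.mpr hb
    have h1 := (map_ne_zero_iff φ hφ).mpr hCb
    have h2 := (map_ne_zero_iff ψ hψ).mpr hCb
    simp only [map_add, map_pow]
    exact ⟨fun _ => by positivity, fun _ => by positivity⟩
  · intro f g hf hg ihf ihg
    have hφf := (map_ne_zero_iff φ hφ).mpr hf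
    have hφg := (map_ne_zero_iff φ hφ).mpr hg
    have hψf := (map_ne_zero_iff ψ hψ).mpr hf
    have hψg := (map_ne_zero_iff ψ hψ).mpr hg
    have neg : (φ f < 0 ↔ ψ f < 0) ∧ (φ g < 0 ↔ ψ g < 0) := by
      constructor
      · rw [← not_lt.trans hφf.le_iff_lt, ← not_lt.trans hψf.le_iff_lt, ihf]
      · rw [← not_lt.trans hφg.le_iff_lt, ← not_lt.trans hψg.le_iff_lt, ihg]
    rw [map_mul, map_mul, mul_pos_iff, mul_pos_iff, ihf, ihg, neg.1, neg.2]

end IsRealClosed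

namespace FieldOrdering

variable [IsStrictOrderedRing R] [IsRealClosed R]

/-- Over a real closed field, two orderings of `R(x)` corresponding to the same cut agree. -/
theorem CorrespondsTo.unique {C : OrderCut R} {P Q : FieldOrdering (RatFunc R)}
    (hP : P.CorrespondsTo C) (hQ : Q.CorrespondsTo C) : P = Q := by
  obtain ⟨p, hp⟩ := P
  obtain ⟨q, hq⟩ := Q
  have hinj : Function.Injective (algebraMap R[X] (RatFunc R)) := RatFunc.algebraMap_injective R
  have hsub : ∀ (o : LinearOrder (RatFunc R)) (_ : IsStrictOrderedRing (RatFunc R))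
      (f g : RatFunc R), o.lt f g ↔ o.lt 0 (g - f) := fun o _ f g => sub_pos.symm
  have hlin : ∀ a : R, p.lt 0 (algebraMap R[X] (RatFunc R) (X - Polynomial.C a)) ↔
      q.lt 0 (algebraMap R[X] (RatFunc R) (X - Polynomial.C a)) := by
    intro a
    rw [map_sub, RatFunc.algebraMap_X, RatFunc.algebraMap_C, ← hsub p hp, ← hsub q hq]
    exact Set.ext_iff.mp (hP.1.symm.trans hQ.1) a
  have hpol := @IsRealClosed.polynomial_pos_iff_pos R _ _ _ _ (RatFunc R) (RatFunc R) _ p hp _ q hq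
    (algebraMap R[X] (RatFunc R)) (algebraMap R[X] (RatFunc R)) hinj hinj hlin
  -- Multiplying by the square of the denominator reduces signs of fractions to signs of
  -- polynomials.
  have hquot : ∀ (o : LinearOrder (RatFunc R)) (_ : IsStrictOrderedRing (RatFunc R))
      (f : RatFunc R), o.lt 0 f ↔ o.lt 0 (algebraMap R[X] (RatFunc R) (f.num * f.denom)) := by
    intro o _ f
    have hd : algebraMap R[X] (RatFunc R) f.denom ≠ 0 :=
      RatFunc.algebraMap_ne_zero f.denom_ne_zero
    have hf : algebraMap R[X] (RatFunc R) (f.num * f.denom) =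
        f * (algebraMap R[X] (RatFunc R) f.denom) ^ 2 := by
      conv_rhs => rw [← RatFunc.num_div_denom f]
      rw [map_mul]
      field_simp
      simp
    rw [hf]
    exact (mul_pos_iff_of_pos_right (by positivity)).symm
  have : p = q := LinearOrder.ext_lt fun f g => by
    rw [hsub p hp, hsub q hq, hquot p hp, hquot q hq]
    exact hpol _
  subst this
  rfl

end FieldOrdering

end CutOrdering

/-! ### Archimedean classes as values -/

section ArchimedeanClassField

variable {F : Type*} [Field F] [LinearOrder F] [IsStrictOrderedRing F]

namespace ArchimedeanClass

/-- The class of a sum of two squares is that of one of the summands. -/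
theorem mk_sq_add_sq (s t : F) :
    mk (s ^ 2 + t ^ 2) = mk (s ^ 2) ∨ mk (s ^ 2 + t ^ 2) = mk (t ^ 2) := by
  have key : ∀ s t : F, mk (s ^ 2) ≤ mk (t ^ 2) → mk (s ^ 2 + t ^ 2) = mk (s ^ 2) := by
    intro s t h
    refine le_antisymm (mk_le_mk_of_abs ?_) (mk_left_le_mk_add h)
    rw [abs_of_nonneg (sq_nonneg s), abs_of_nonneg (by positivity)]
    linarith [sq_nonneg t]
  rcases le_total (mk (s ^ 2)) (mk (t ^ 2)) with h | h
  · exact Or.inl (key s t h)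
  · right
    rw [add_comm]
    exact key t s h

/-- An ordered group has no torsion. Because of `⊤` the classes are not a group, so negative `k` is
treated through a representative. -/
theorem eq_zero_of_zsmul_eq_zero {a : ArchimedeanClass F} {k : ℤ} (hk : k ≠ 0)
    (h : k • a = 0) : a = 0 := by
  have hn : k.natAbs • a = 0 := by
    rcases Int.natAbs_eq k with hk' | hk'
    · rw [hk', natCast_zsmul] at h
      exact h
    · obtain ⟨z, rfl⟩ := mk_surjective F a
      rw [hk', ← mk_zpow, zpow_neg, mk_inv, mk_zpow, natCast_zsmul] at h
      rw [← neg_neg (k.natAbs • mk z), h, neg_zero]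
  have hk0 : k.natAbs ≠ 0 := Int.natAbs_ne_zero.mpr hk
  rcases lt_trichotomy a 0 with ha | ha | ha
  · exact absurd hn (nsmul_neg ha hk0).ne
  · exact ha
  · exact absurd hn (nsmul_pos ha hk0).ne'

theorem mk_eq_mk_of_mk_zpow_eq {y z : F} (hz : z ≠ 0) {k : ℤ} (hk : k ≠ 0)
    (h : mk (y ^ k) = mk (z ^ k)) : mk y = mk z := by
  have h0 : mk (y / z) = 0 := by
    refine eq_zero_of_zsmul_eq_zero hk ?_
    rw [← mk_zpow, div_zpow, div_eq_mul_inv, mk_mul, h, ← mk_mul,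
      mul_inv_cancel₀ (zpow_ne_zero k hz), mk_one]
  rw [← div_mul_cancel₀ y hz, mk_mul, h0, zero_add]

theorem exists_ne_zero_of_addUnits (u : AddUnits (ArchimedeanClass F)) :
    ∃ z : F, z ≠ 0 ∧ (u : ArchimedeanClass F) = mk z := by
  obtain ⟨z, hz⟩ := mk_surjective F (u : ArchimedeanClass F)
  refine ⟨z, ?_, hz.symm⟩
  rintro rfl
  exact LinearOrderedAddCommGroupWithTop.isAddUnit_iff.mp u.isAddUnit (hz.symm.trans (by simp))

theorem exists_addUnits {z : F} (hz : z ≠ 0) :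
    ∃ u : AddUnits (ArchimedeanClass F), (u : ArchimedeanClass F) = mk z := by
  have : IsAddUnit (mk z) := LinearOrderedAddCommGroupWithTop.isAddUnit_iff.mpr (by simpa using hz)
  exact ⟨this.addUnit, rfl⟩

theorem mem_range_two_nsmul_iff (u : NaturalValueGroup F) :
    u ∈ (nsmulAddMonoidHom (α := NaturalValueGroup F) 2).range ↔
      ∃ w : F, w ≠ 0 ∧ (u : ArchimedeanClass F) = mk (w ^ 2) := by
  rw [AddMonoidHom.mem_range]
  constructor
  · rintro ⟨w, rfl⟩
    obtain ⟨z, hz, hw⟩ := exists_ne_zero_of_addUnits w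
    refine ⟨z, hz, ?_⟩
    rw [mk_pow, ← hw]
    rfl
  · rintro ⟨w, hw, hu⟩
    obtain ⟨v, hv⟩ := exists_addUnits hw
    refine ⟨v, AddUnits.ext ?_⟩
    rw [hu, mk_pow, ← hv]
    rfl

end ArchimedeanClass

end ArchimedeanClassField

/-! ### The value group of `R(x)` modulo two -/

section ValueGroup

open ArchimedeanClass

variable {R : Type*} [Field R] [LinearOrder R] [IsStrictOrderedRing R] [IsRealClosed R]
  {F : Type*} [Field F] [LinearOrder F] [IsStrictOrderedRing F] {φ : R[X] →+* F}

/-- Values ignore signs and `|a|` is a square in `R`; this is the 2-divisibility of `vR`. -/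
theorem exists_mk_C_eq_mk_sq (φ : R[X] →+* F) (a : R) :
    ∃ s : R, mk (φ (C a)) = mk (φ (C s) ^ 2) := by
  obtain ⟨s, hs⟩ := IsRealClosed.exists_eq_pow_of_nonneg (abs_nonneg a) two_ne_zero
  refine ⟨s, ?_⟩
  rw [← map_pow, ← map_pow, ← hs]
  rcases abs_choice a with h | h
  · rw [h]
  · rw [h, map_neg, map_neg, mk_neg]

/-- If every `x - a` has the value of a constant, then the value group of `R(x)` is
`2`-divisible. -/
theorem exists_mk_eq_mk_sq_of_forall
    (h : ∀ a, ∃ b, mk (φ (X - C a)) = mk (φ (C b))) {f : R[X]} (hf : f ≠ 0) :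
    ∃ w : F, mk (φ f) = mk (w ^ 2) := by
  refine IsRealClosed.polynomial_induction (motive := fun f => ∃ w : F, mk (φ f) = mk (w ^ 2))
    ?_ ?_ ?_ ?_ hf
  · intro a _
    obtain ⟨s, hs⟩ := exists_mk_C_eq_mk_sq φ a
    exact ⟨_, hs⟩
  · intro a
    obtain ⟨b, hb⟩ := h a
    obtain ⟨s, hs⟩ := exists_mk_C_eq_mk_sq φ b
    exact ⟨_, hb.trans hs⟩
  · intro a b _
    rw [map_add, map_pow, map_pow]
    rcases mk_sq_add_sq (φ (X - C a)) (φ (C b)) with h | h <;> exact ⟨_, h⟩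
  · rintro f g _ _ ⟨w, hw⟩ ⟨z, hz⟩
    exact ⟨w * z, by rw [map_mul, mk_mul, hw, hz, ← mk_mul, mul_pow]⟩

/-- If the value of `x - a₀` is not that of a constant, then the value group of `R(x)` is generated
by it and the values of constants. -/
theorem exists_mk_eq_mk_mul_zpow (hφ : Function.Injective φ) {a₀ : R}
    (h : ∀ b, mk (φ (X - C a₀)) ≠ mk (φ (C b))) {f : R[X]} (hf : f ≠ 0) :
    ∃ (b : R) (n : ℤ), b ≠ 0 ∧ mk (φ f) = mk (φ (C b) * φ (X - C a₀) ^ n) := by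
  set y := φ (X - C a₀) with hy
  have hy0 : y ≠ 0 := (map_ne_zero_iff φ hφ).mpr (X_sub_C_ne_zero a₀)
  have linear : ∀ a, ∃ (b : R) (n : ℤ), b ≠ 0 ∧ mk (φ (X - C a)) = mk (φ (C b) * y ^ n) := by
    intro a
    have hsum : φ (X - C a) = y + φ (C (a₀ - a)) := by
      rw [hy, ← map_add, C_sub]
      congr 1
      ring
    -- The two summands have different values, so the sum takes the smaller one.
    rcases lt_or_gt_of_ne (h (a₀ - a)) with hlt | hlt
    · exact ⟨1, 1, one_ne_zero, by
        rw [hsum, mk_add_eq_mk_left hlt, C_1, map_one, one_mul, zpow_one]⟩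
    · refine ⟨a₀ - a, 0, ?_, by rw [hsum, mk_add_eq_mk_right hlt, zpow_zero, mul_one]⟩
      rintro h0
      rw [h0] at hlt
      simp at hlt
  have mul : ∀ f g : R[X],
      (∃ (b : R) (n : ℤ), b ≠ 0 ∧ mk (φ f) = mk (φ (C b) * y ^ n)) →
      (∃ (b : R) (n : ℤ), b ≠ 0 ∧ mk (φ g) = mk (φ (C b) * y ^ n)) →
      ∃ (b : R) (n : ℤ), b ≠ 0 ∧ mk (φ (f * g)) = mk (φ (C b) * y ^ n) := by
    rintro f g ⟨b, n, hb, hf⟩ ⟨c, m, hc, hg⟩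
    refine ⟨b * c, n + m, mul_ne_zero hb hc, ?_⟩
    rw [map_mul, mk_mul, hf, hg, ← mk_mul, zpow_add₀ hy0, C_mul, map_mul]
    congr 1
    ring
  refine IsRealClosed.polynomial_induction
    (motive := fun f => ∃ (b : R) (n : ℤ), b ≠ 0 ∧ mk (φ f) = mk (φ (C b) * y ^ n))
    ?_ linear ?_ (fun f g _ _ => mul f g) hf
  · exact fun a ha => ⟨a, 0, ha, by simp⟩
  · intro a b hb
    rw [map_add, map_pow, map_pow]
    rcases mk_sq_add_sq (φ (X - C a)) (φ (C b)) with h | h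
    · rw [h, ← map_pow, sq]
      exact mul _ _ (linear a) (linear a)
    · exact ⟨b ^ 2, 0, pow_ne_zero 2 hb, by rw [h]; simp⟩

theorem exists_mk_eq_mk_mul_zpow_of_surj (hφ : Function.Injective φ)
    (hgen : ∀ z : F, ∃ f g, z = φ f / φ g) {a₀ : R}
    (h : ∀ b, mk (φ (X - C a₀)) ≠ mk (φ (C b))) {z : F} (hz : z ≠ 0) :
    ∃ (b : R) (n : ℤ), b ≠ 0 ∧ mk z = mk (φ (C b) * φ (X - C a₀) ^ n) := by
  have hy0 : φ (X - C a₀) ≠ 0 := (map_ne_zero_iff φ hφ).mpr (X_sub_C_ne_zero a₀)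
  obtain ⟨f, g, rfl⟩ := hgen z
  have hf : f ≠ 0 := by rintro rfl; simp at hz
  have hg : g ≠ 0 := by rintro rfl; simp at hz
  obtain ⟨b, n, hb, hfb⟩ := exists_mk_eq_mk_mul_zpow hφ h hf
  obtain ⟨c, m, hc, hgc⟩ := exists_mk_eq_mk_mul_zpow hφ h hg
  refine ⟨b / c, n - m, div_ne_zero hb hc, ?_⟩
  have hdiv : φ (C (b / c)) = φ (C b) / φ (C c) := map_div₀ (φ.comp C) b c
  have hc0 : φ (C c) ≠ 0 := (map_ne_zero_iff φ hφ).mpr (C_ne_zero.mpr hc)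
  rw [div_eq_mul_inv, mk_mul, mk_inv, hfb, hgc, ← mk_inv, ← mk_mul, hdiv, zpow_sub₀ hy0]
  congr 1
  field_simp

/-- If the value of `y = x - a₀` is not that of a constant, then the value of `b y ^ n` is
divisible by two exactly if `n` is even. -/
theorem mem_range_two_nsmul_iff_even (hφ : Function.Injective φ)
    (hgen : ∀ z : F, ∃ f g, z = φ f / φ g) {a₀ : R}
    (h : ∀ b, mk (φ (X - C a₀)) ≠ mk (φ (C b))) {u : NaturalValueGroup F} {c : R} (hc : c ≠ 0)
    {n : ℤ} (hu : (u : ArchimedeanClass F) = mk (φ (C c) * φ (X - C a₀) ^ n)) :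
    u ∈ (nsmulAddMonoidHom (α := NaturalValueGroup F) 2).range ↔ Even n := by
  have hy0 : φ (X - C a₀) ≠ 0 := (map_ne_zero_iff φ hφ).mpr (X_sub_C_ne_zero a₀)
  have hC0 : ∀ {b : R}, b ≠ 0 → φ (C b) ≠ 0 := fun hb =>
    (map_ne_zero_iff φ hφ).mpr (C_ne_zero.mpr hb)
  rw [mem_range_two_nsmul_iff]
  constructor
  · rintro ⟨w, hw, huw⟩
    by_contra hn
    rw [Int.not_even_iff_odd] at hn
    -- Write `y = x - a₀`. Comparing `c yⁿ` with `(d yᵐ)²` gives `y ^ (n - 2m)` the value of `d² /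
    -- c`. The exponent is odd, so `d² / c` has a root `r` of that order in `R`, and `y` gets the
    -- value of `r`, against `h`.
    obtain ⟨d, m, hd, hwd⟩ := exists_mk_eq_mk_mul_zpow_of_surj hφ hgen h hw
    have hodd : Odd (n - 2 * m) := hn.sub_even (even_two_mul m)
    obtain ⟨r, hr⟩ := IsRealClosed.exists_eq_zpow_of_odd (d ^ 2 / c) hodd
    have hk : n - 2 * m ≠ 0 := by
      rintro h0
      rw [h0] at hodd
      simp at hodd
    have hr0 : r ≠ 0 := by
      rintro rfl
      rw [zero_zpow _ hk] at hr
      exact div_ne_zero (pow_ne_zero 2 hd) hc hr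
    refine h r (mk_eq_mk_of_mk_zpow_eq (hC0 hr0) hk ?_)
    have hri : φ (C r) ^ (n - 2 * m) = φ (C d) ^ 2 / φ (C c) := by
      have := congrArg (φ.comp C) hr
      rw [map_zpow₀, map_div₀, map_pow] at this
      exact this.symm
    have heq : mk (φ (C c) * φ (X - C a₀) ^ n) = mk ((φ (C d) * φ (X - C a₀) ^ m) ^ 2) := by
      rw [← hu, huw, mk_pow, mk_pow, hwd]
    have hmul := congrArg (· + mk ((φ (C c))⁻¹ * φ (X - C a₀) ^ (-(2 * m)))) heq
    simp only [← mk_mul] at hmul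
    have h1 := hC0 hc
    have e1 : φ (C c) * φ (X - C a₀) ^ n * ((φ (C c))⁻¹ * φ (X - C a₀) ^ (-(2 * m))) =
        φ (X - C a₀) ^ (n - 2 * m) := by
      rw [sub_eq_add_neg n, zpow_add₀ hy0]
      field_simp
    have e2 : (φ (C d) * φ (X - C a₀) ^ m) ^ 2 * ((φ (C c))⁻¹ * φ (X - C a₀) ^ (-(2 * m))) =
        φ (C d) ^ 2 / φ (C c) := by
      have : φ (X - C a₀) ^ (2 * m) = (φ (X - C a₀) ^ m) ^ 2 := by
        rw [mul_comm, zpow_mul]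
        norm_cast
      have hm : φ (X - C a₀) ^ m ≠ 0 := zpow_ne_zero m hy0
      rw [zpow_neg, this]
      field_simp
    rw [e1, e2] at hmul
    rw [hmul, hri]
  · rintro ⟨m, rfl⟩
    obtain ⟨s, hs⟩ := exists_mk_C_eq_mk_sq φ c
    have hs0 : s ≠ 0 := by
      rintro rfl
      have : mk (φ (C c)) = ⊤ := by rw [hs]; simp
      exact hC0 hc (mk_eq_top_iff.mp this)
    refine ⟨φ (C s) * φ (X - C a₀) ^ m, mul_ne_zero (hC0 hs0) (zpow_ne_zero m hy0), ?_⟩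
    rw [hu, mk_mul, hs, ← mk_mul, mul_pow, zpow_add₀ hy0, sq (φ (X - C a₀) ^ m)]

/-- The index `[vR(x) : 2vR(x)]` is two exactly if some `x - a` has a value outside `vR`. -/
theorem naturalValueIndexTwo_eq_two_iff (hφ : Function.Injective φ)
    (hgen : ∀ z : F, ∃ f g, z = φ f / φ g) :
    naturalValueIndexTwo F = 2 ↔ ∃ a, ∀ b, mk (φ (X - C a)) ≠ mk (φ (C b)) := by
  constructor
  · intro h2
    by_contra! hall
    have htop : (nsmulAddMonoidHom (α := NaturalValueGroup F) 2).range = ⊤ := by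
      rw [eq_top_iff]
      intro u _
      obtain ⟨z, hz, hu⟩ := exists_ne_zero_of_addUnits u
      obtain ⟨f, g, rfl⟩ := hgen z
      have hf : f ≠ 0 := by rintro rfl; simp at hz
      have hg : g ≠ 0 := by rintro rfl; simp at hz
      obtain ⟨s, hs⟩ := exists_mk_eq_mk_sq_of_forall hall hf
      obtain ⟨t, ht⟩ := exists_mk_eq_mk_sq_of_forall hall hg
      have hst : mk (φ f / φ g) = mk ((s / t) ^ 2) := by
        rw [div_eq_mul_inv, mk_mul, mk_inv, hs, ht, ← mk_inv, ← mk_mul, div_pow, div_eq_mul_inv]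
      refine (mem_range_two_nsmul_iff u).mpr ⟨s / t, ?_, hu.trans hst⟩
      intro h0
      rw [h0, zero_pow two_ne_zero, mk_zero, mk_eq_top_iff] at hst
      exact hz hst
    rw [naturalValueIndexTwo, htop, AddSubgroup.index_top] at h2
    omega
  · rintro ⟨a, ha⟩
    have hy0 : φ (X - C a) ≠ 0 := (map_ne_zero_iff φ hφ).mpr (X_sub_C_ne_zero a)
    obtain ⟨α, hα⟩ := exists_addUnits hy0
    rw [naturalValueIndexTwo, AddSubgroup.index_eq_two_iff]
    -- Adding `α = v(x - a)` raises the exponent `n` by one, so exactly one of `u`, `u + α` is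
    -- divisible by two.
    refine ⟨α, fun u => ?_⟩
    obtain ⟨z, hz, hu⟩ := exists_ne_zero_of_addUnits u
    obtain ⟨c, n, hc, hzc⟩ := exists_mk_eq_mk_mul_zpow_of_surj hφ hgen ha hz
    have hsum : ((u + α : NaturalValueGroup F) : ArchimedeanClass F) =
        mk (φ (C c) * φ (X - C a) ^ (n + 1)) := by
      rw [AddUnits.val_add, hu, hzc, hα, ← mk_mul, zpow_add_one₀ hy0, mul_assoc]
    rw [mem_range_two_nsmul_iff_even hφ hgen ha hc (hu.trans hzc),
      mem_range_two_nsmul_iff_even hφ hgen ha hc hsum, Int.even_add_one]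
    by_cases hn : Even n
    · exact Or.inr ⟨hn, not_not.mpr hn⟩
    · exact Or.inl ⟨hn, hn⟩

end ValueGroup

/-! ### Ball cuts and values outside `vR` -/

section BallCuts

open ArchimedeanClass

variable {R : Type*} [Field R] [LinearOrder R] [IsStrictOrderedRing R]

theorem mem_ultrametricBall_iff (S : OrderCut (NaturalValueGroup R)) (a b : R) :
    b ∈ ultrametricBall S a ↔
      b = a ∨ ∃ u ∈ S.upper, mk (b - a) = (u : ArchimedeanClass R) := by
  have h : mk (b - a) = ⊤ ↔ b = a := by rw [mk_eq_top_iff, sub_eq_zero]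
  rw [← h]
  rfl

theorem center_mem_ultrametricBall (S : OrderCut (NaturalValueGroup R)) (a : R) :
    a ∈ ultrametricBall S a :=
  (mem_ultrametricBall_iff S a a).mpr (Or.inl rfl)

/-- Ultrametric balls are closed under moving towards the center, up to archimedean equivalence. -/
theorem mem_ultrametricBall_of_mk_le {S : OrderCut (NaturalValueGroup R)} {a b c : R}
    (hb : b ∈ ultrametricBall S a) (h : mk (b - a) ≤ mk (c - a)) :
    c ∈ ultrametricBall S a := by
  rw [mem_ultrametricBall_iff] at hb ⊢
  rcases eq_or_ne c a with hc | hc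
  · exact Or.inl hc
  right
  obtain ⟨w, hw⟩ := exists_addUnits (sub_ne_zero.mpr hc)
  refine ⟨w, ?_, hw.symm⟩
  rcases hb with rfl | ⟨u, hu, hbu⟩
  · rw [sub_self, mk_zero, top_le_iff, mk_eq_top_iff] at h
    exact absurd h (sub_ne_zero.mpr hc)
  · refine (S.mem_lower_or_mem_upper w).resolve_left fun hwl => ?_
    have hlt : (w : ArchimedeanClass R) < u := AddUnits.val_lt_val.mpr (S.lt_of_mem w hwl u hu)
    rw [hw, ← hbu] at hlt
    exact absurd h (not_le.mpr hlt)

variable {F : Type*} [Field F] [LinearOrder F] [IsStrictOrderedRing F]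

theorem abs_map_of_strictMono {i : R →+* F} (hi : StrictMono i) (a : R) : |i a| = i |a| := by
  rw [abs_eq_max_neg, abs_eq_max_neg, hi.monotone.map_max, map_neg]

/-- The comparison involves only absolute values and natural multiples, which `i` respects; hence
`vR` embeds into `vF`. -/
theorem mk_map_le_mk_map_iff {i : R →+* F} (hi : StrictMono i) {a b : R} :
    mk (i a) ≤ mk (i b) ↔ mk a ≤ mk b := by
  simp only [mk_le_mk, abs_map_of_strictMono hi, ← map_nsmul, hi.le_iff_le]

theorem mk_map_lt_mk_map_iff {i : R →+* F} (hi : StrictMono i) {a b : R} :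
    mk (i a) < mk (i b) ↔ mk a < mk b :=
  lt_iff_lt_of_le_iff_le (mk_map_le_mk_map_iff hi)

/-- If the value of `y` is not that of an element of `R`, then the elements of `R` of larger value
form an ultrametric ball. -/
theorem exists_ultrametricBall {i : R →+* F} (hi : StrictMono i) {y : F}
    (hy : ∀ b, mk y ≠ mk (i b)) (a : R) :
    ∃ S : OrderCut (NaturalValueGroup R),
      ∀ b, b ∈ ultrametricBall S a ↔ mk y < mk (i (b - a)) := by
  -- This is the cut that the value of `y` induces in `vR`; by `hy` every element falls strictly on
  -- one side.
  let S : OrderCut (NaturalValueGroup R) :=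
    { lower := {u | ∃ d, (u : ArchimedeanClass R) = mk d ∧ mk (i d) < mk y}
      upper := {u | ∃ d, (u : ArchimedeanClass R) = mk d ∧ mk y < mk (i d)}
      union_eq := by
        refine Set.eq_univ_of_forall fun u => ?_
        obtain ⟨d, -, hd⟩ := exists_ne_zero_of_addUnits u
        rcases lt_or_gt_of_ne (hy d) with h | h
        · exact Or.inr ⟨d, hd, h⟩
        · exact Or.inl ⟨d, hd, h⟩
      lt_of_mem := by
        rintro l ⟨d, hd, hdy⟩ u ⟨e, he, hey⟩
        rw [← AddUnits.val_lt_val, hd, he]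
        exact (mk_map_lt_mk_map_iff hi).mp (hdy.trans hey) }
  refine ⟨S, fun b => ?_⟩
  rw [mem_ultrametricBall_iff]
  constructor
  · rintro (rfl | ⟨u, ⟨d, hd, hdy⟩, hu⟩)
    · have := hy 0
      rw [map_zero, mk_zero] at this
      rw [sub_self, map_zero, mk_zero]
      exact lt_top_iff_ne_top.mpr this
    · refine hdy.trans_le ((mk_map_le_mk_map_iff hi).mpr ?_)
      rw [hu, hd]
  · intro h
    rcases eq_or_ne b a with hb | hb
    · exact Or.inl hb
    · obtain ⟨u, hu⟩ := exists_addUnits (sub_ne_zero.mpr hb)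
      exact Or.inr ⟨u, ⟨b - a, hu, h⟩, hu.symm⟩

/-- A cut filled by `x` is a ball cut if some `x - a` has a value outside `vR`. -/
theorem isBallCut_of_forall_mk_ne {i : R →+* F} (hi : StrictMono i) {x : F}
    {C : OrderCut R} (hC : C.lower = {a | i a < x}) {a : R}
    (ha : ∀ b, mk (x - i a) ≠ mk (i b)) : C.IsBallCut := by
  obtain ⟨S, hS⟩ := exists_ultrametricBall hi ha a
  refine ⟨S, a, ?_⟩
  have hne : x ≠ i a := by
    rintro h
    have := ha 0
    simp [h] at this
  rcases lt_or_gt_of_ne hne with hxa | hxa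
  · left
    refine OrderCut.ext_lower (Set.ext fun c => ?_)
    rw [hC]
    change i c < x ↔ ∀ s ∈ ultrametricBall S a, c < s
    constructor
    · intro hc s hs
      have h1 := lt_of_mk_lt_mk_of_nonpos ((hS s).mp hs) (sub_neg.mpr hxa).le
      rw [map_sub, sub_lt_sub_iff_right] at h1
      exact hi.lt_iff_lt.mp (hc.trans h1)
    · intro h
      by_contra! hc
      have hca := h a (center_mem_ultrametricBall S a)
      refine (h c ((hS c).mpr (lt_of_le_of_ne ?_ (ha _)))).false
      refine mk_le_mk_of_abs ?_
      -- With `x ≤ c < a`, the point `c` is at least as close to `a` as `x`; the values differ by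
      -- `ha`, so `c` is in the ball and would lie below itself.
      have h1 : i (c - a) < 0 := by rw [map_sub, sub_neg]; exact hi hca
      rw [abs_of_neg h1, abs_of_neg (sub_neg.mpr hxa), neg_le_neg_iff, map_sub]
      exact sub_le_sub_right hc _
  · right
    refine OrderCut.ext_lower (Set.ext fun c => ?_)
    rw [hC]
    change i c < x ↔ ∃ s ∈ ultrametricBall S a, c ≤ s
    constructor
    · intro hc
      rcases le_or_gt c a with hca | hca
      · exact ⟨a, center_mem_ultrametricBall S a, hca⟩
      refine ⟨c, (hS c).mpr (lt_of_le_of_ne ?_ (ha _)), le_rfl⟩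
      refine mk_le_mk_of_abs ?_
      have h1 : 0 < i (c - a) := by rw [map_sub, sub_pos]; exact hi hca
      rw [abs_of_pos h1, abs_of_pos (sub_pos.mpr hxa), map_sub]
      exact sub_le_sub_right hc.le _
    · rintro ⟨s, hs, hcs⟩
      have h1 := lt_of_mk_lt_mk_of_nonneg ((hS s).mp hs) (sub_pos.mpr hxa).le
      rw [map_sub, sub_lt_sub_iff_right] at h1
      exact (hi.monotone hcs).trans_lt h1

/-- An element of an ordered extension of `R` with a value in `vR` lies between two elements of `R`
of that value. -/
theorem exists_between_of_mk_eq {i : R →+* F} (hi : StrictMono i) {y : F} (hy : 0 < y) {b : R}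
    (h : mk y = mk (i b)) : ∃ d e : R, 0 < d ∧ mk d = mk e ∧ i d < y ∧ y < i e := by
  have hb : b ≠ 0 := by
    rintro rfl
    rw [map_zero, mk_zero, mk_eq_top_iff] at h
    exact hy.ne' h
  have hib : i b ≠ 0 := (map_ne_zero i).mpr hb
  -- Archimedean equivalence gives `|b| < m y` and `y < n |b|`, hence the bounds `|b| / m` and `n
  -- |b|`.
  obtain ⟨m, hm⟩ := (mk_le_mk_iff_lt hy.ne').mp h.le
  obtain ⟨n, hn⟩ := (mk_le_mk_iff_lt hib).mp h.ge
  rw [abs_map_of_strictMono hi, abs_of_pos hy] at hm hn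
  have hm0 : (0 : R) < m := by
    rcases Nat.eq_zero_or_pos m with rfl | hm0
    · rw [zero_nsmul, ← map_zero i, hi.lt_iff_lt] at hm
      exact absurd hm (not_lt.mpr (abs_nonneg b))
    · exact_mod_cast hm0
  have hn0 : n ≠ 0 := by
    rintro rfl
    rw [zero_nsmul] at hn
    exact absurd hn (not_lt.mpr hy.le)
  refine ⟨|b| / m, n • |b|, div_pos (abs_pos.mpr hb) hm0, ?_, ?_, ?_⟩
  · rw [mk_div, mk_natCast (by exact_mod_cast hm0.ne'), sub_zero, nsmul_eq_mul, mk_mul,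
      mk_natCast hn0, zero_add]
  · rw [map_div₀, map_natCast, div_lt_iff₀ (by exact_mod_cast hm0), mul_comm, ← nsmul_eq_mul]
    exact hm
  · rwa [map_nsmul]

/-- If the cut filled by `x` is a ball cut, then some `x - a` has a value outside `vR`. -/
theorem exists_forall_mk_ne_of_isBallCut {i : R →+* F} (hi : StrictMono i) {x : F}
    {C : OrderCut R} (hC : C.lower = {a | i a < x}) (hC' : C.upper = {a | x < i a})
    (h : C.IsBallCut) : ∃ a, ∀ b, mk (x - i a) ≠ mk (i b) := by
  obtain ⟨S, a, h⟩ := h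
  refine ⟨a, fun b hb => ?_⟩
  rcases h with h | h
  · have hu : ∀ c, x < i c ↔ ∃ s ∈ ultrametricBall S a, s ≤ c := fun c => by
      rw [h] at hC'
      exact (Set.ext_iff.mp hC' c).symm
    have hxa : x < i a := (hu a).mpr ⟨a, center_mem_ultrametricBall S a, le_rfl⟩
    rw [mk_sub_comm] at hb
    -- Here `a - e < x < a - d`. Some `s ≤ a - d` is in the ball, and `d`, `e` have equal value, so
    -- `a - e` is in the ball too, although it lies below `x`.
    obtain ⟨d, e, hd, hde, hdx, hxe⟩ := exists_between_of_mk_eq hi (sub_pos.mpr hxa) hb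
    obtain ⟨s, hs, hsd⟩ := (hu (a - d)).mp (by rw [map_sub]; linarith)
    have hmem : a - e ∈ ultrametricBall S a := by
      refine mem_ultrametricBall_of_mk_le hs ?_
      rw [sub_sub_cancel_left, mk_neg, ← hde, ← mk_neg d]
      refine mk_le_mk_of_abs ?_
      rw [abs_neg, abs_of_pos hd, abs_of_nonpos (by linarith)]
      linarith
    have := (hu (a - e)).mpr ⟨a - e, hmem, le_rfl⟩
    rw [map_sub] at this
    linarith
  · have hl : ∀ c, i c < x ↔ ∃ s ∈ ultrametricBall S a, c ≤ s := fun c => by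
      rw [h] at hC
      exact (Set.ext_iff.mp hC c).symm
    have hxa : i a < x := (hl a).mpr ⟨a, center_mem_ultrametricBall S a, le_rfl⟩
    obtain ⟨d, e, hd, hde, hdx, hxe⟩ := exists_between_of_mk_eq hi (sub_pos.mpr hxa) hb
    obtain ⟨s, hs, hsd⟩ := (hl (a + d)).mp (by rw [map_add]; linarith)
    have hmem : a + e ∈ ultrametricBall S a := by
      refine mem_ultrametricBall_of_mk_le hs ?_
      rw [add_sub_cancel_left, ← hde]
      refine mk_le_mk_of_abs ?_
      rw [abs_of_pos hd, abs_of_nonneg (by linarith)]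
      linarith
    have := (hl (a + e)).mpr ⟨a + e, hmem, le_rfl⟩
    rw [map_add] at this
    linarith

end BallCuts

/-! ### The equivalence for `R(x)` -/

section RationalFunctions

open ArchimedeanClass

variable {R : Type*} [Field R] [LinearOrder R] [IsStrictOrderedRing R] [IsRealClosed R]

theorem isBallCut_iff_naturalValueIndexTwo [LinearOrder (RatFunc R)]
    [IsStrictOrderedRing (RatFunc R)] {D : OrderCut R}
    (hl : D.lower = {a | RatFunc.C a < RatFunc.X}) (hu : D.upper = {a | RatFunc.X < RatFunc.C a}) :
    D.IsBallCut ↔ naturalValueIndexTwo (RatFunc R) = 2 := by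
  have hi : StrictMono (RatFunc.C : R →+* RatFunc R) := IsRealClosed.strictMono_ringHom _
  have hval := naturalValueIndexTwo_eq_two_iff (φ := algebraMap R[X] (RatFunc R))
    (RatFunc.algebraMap_injective R)
    (fun z => ⟨z.num, z.denom, (RatFunc.num_div_denom z).symm⟩)
  simp only [map_sub, RatFunc.algebraMap_X, RatFunc.algebraMap_C] at hval
  rw [hval]
  exact ⟨fun h => exists_forall_mk_ne_of_isBallCut hi hl hu h, fun ⟨a, ha⟩ => isBallCut_of_forall_mk_ne hi hl ha⟩

end RationalFunctions

theorem mainTheorem8 (R : Type*) [Field R] [LinearOrder R] [IsStrictOrderedRing R]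
    [IsRealClosed R] (C : OrderCut R) :
    (∃! P : FieldOrdering (RatFunc R), P.CorrespondsTo C) ∧
      ∀ P : FieldOrdering (RatFunc R), P.CorrespondsTo C →
        (C.IsBallCut ↔ P.valueIndexTwo = 2) := by
  obtain ⟨P, hP⟩ := C.exists_correspondsTo
  refine ⟨⟨P, hP, fun Q hQ => hQ.unique hP⟩, fun Q hQ => ?_⟩
  let := Q.order
  have := Q.isStrictOrderedRing
  exact isBallCut_iff_naturalValueIndexTwo hQ.1 hQ.2
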